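/- **Theorem 3.3 (robust error bound for the (skew-)symmetric matrix integrator).** Throughout, $\|\cdot\|$ is the Frobenius norm, and "(skew-)symmetric" means either "symmetric" everywhere or "skew-symmetric" everywhere. For all real $L,B,T$ there are constants $c_0,c_1,c_2\ge 0$, depending only on $L$, $B$ and $T$ (in particular not on the matrix dimensions or on singular values of the exact or approximate solution), such that the following holds. Let $F:\mathbb R\times\mathbb R^{d\times d}\to\mathbb R^{d\times d}$ be such that, for $0\le t\le T$, $F(t,Y)$ is (skew-)symmetric whenever $Y$ is, and let $A:[0,T]\to\mathbb R^{d\times d}$ be a (skew-)symmetric solution of $\dot A(t)=F(t,A(t))$. Let $r\ge 0$, $\delta,\varepsilon\ge0$, $h>0$, $\rho>0$, and assume: 1. $\|F(t,Y)-F(t,\widetilde Y)\|\le L\|Y-\widetilde Y\|$ and $\|F(t,Y)\|\le B$ for all $Y,\widetilde Y\in\mathbb R^{d\times d}$ and $0\le t\le T$. 2. $\|(I-\mathrm P(Y))F(t,Y)\|\le\varepsilon$ for all $0\le t\le T$ and all $Y\in\mathbb R^{d\times d}$ of rank $r$ with $\|Y-A(t)\|<\rho$. Here $\mathrm P(Y)Z=ZVV^\top-UU^\top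 ZVV^\top+UU^\top Z$ is the orthogonal projection onto the tangent space at $Y$ of the manifold of rank-$r$ matrices, where $Y=USV^\top$ with $U,V\in\mathbb R^{d\times r}$ having orthonormal columns and $S\in\mathbb R^{r\times r}$ invertible. The neighbourhood is not smaller than the error bound: $c_0\delta+c_1\varepsilon+c_2h\le\rho$. 3. $Y_0=U_0S_0U_0^\top$, where $U_0\in\mathbb R^{d\times r}$ has orthonormal columns and $S_0\in\mathbb R^{r\times r}$ is (skew-)symmetric, satisfies $\|Y_0-A(0)\|\le\delta$. Let $t_k=kh$ and let $Y_n=U_nS_nU_n^\top$ be obtained after $n$ steps of the following integrator. Given $U_k,S_k$: solve $\dot K(t)=F(t,K(t)U_k^\top)U_k$, $K(t_k)=U_kS_k$ on $[t_k,t_{k+1}]$ and take any QR factorization $K(t_{k+1})=U_{k+1}R$ ($U_{k+1}\in\mathbb R^{d\times r}$ with orthonormal columns, $R$ upper triangular); then solve $\dot S(t)=U_{k+1}^\top F(t,U_{k+1}S(t)U_{k+1}^\top)U_{k+1}$, $S(t_k)=U_{k+1}^\top U_kS_kU_k^\top U_{k+1}$ on $[t_k,t_{k+1}]$ and set $S_{k+1}=S(t_{k+1})$.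 If $t_n=nh\le T$, then $$\|Y_n-A(t_n)\|\le c_0\delta+c_1\varepsilon+c_2h .$$ -/

import Mathlib

open scoped Matrix Matrix.Norms.Frobenius

namespace LowRank

/-- `Mᵀ = σ M`: symmetric for `σ = 1`, skew-symmetric for `σ = -1`. -/
def HasSymmetry {m : ℕ} (σ : ℝ) (M : Matrix (Fin m) (Fin m) ℝ) : Prop :=
  Mᵀ = σ • M

/-- The SVD-like factorization `Y = U S Vᵀ` of a matrix of rank exactly `r`: `U` and `V` have `r`
orthonormal columns and `S` is an invertible `r × r` matrix. -/
structure IsRankFactorization {d r : ℕ} (Y : Matrix (Fin d) (Fin d) ℝ)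
    (U : Matrix (Fin d) (Fin r) ℝ) (S : Matrix (Fin r) (Fin r) ℝ)
    (V : Matrix (Fin d) (Fin r) ℝ) : Prop where
  left_orthonormal : Uᵀ * U = 1
  right_orthonormal : Vᵀ * V = 1
  core_invertible : IsUnit S
  eq_mul : Y = U * S * Vᵀ

/-- The orthogonal projection `P(Y) Z = Z V Vᵀ - U Uᵀ Z V Vᵀ + U Uᵀ Z` onto the tangent space of
the manifold of rank-`r` matrices at `Y = U S Vᵀ`; it depends on `U` and `V` only through their
column spaces, which are the column space and the row space of `Y`. -/
def tangentProjection {d r : ℕ} (U V : Matrix (Fin d) (Fin r) ℝ) (Z : Matrix (Fin d) (Fin d) ℝ) :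
    Matrix (Fin d) (Fin d) ℝ :=
  Z * (V * Vᵀ) - (U * Uᵀ) * Z * (V * Vᵀ) + (U * Uᵀ) * Z

/-- The function `A` solves `A' = G(t, A)` on the closed interval `[a, b]` (one-sided derivatives at
the end points), for matrices of any size. -/
def SolvesOn {m k : ℕ} (G : ℝ → Matrix (Fin m) (Fin k) ℝ → Matrix (Fin m) (Fin k) ℝ)
    (a b : ℝ) (A : ℝ → Matrix (Fin m) (Fin k) ℝ) : Prop :=
  ∀ t ∈ Set.Icc a b, HasDerivWithinAt A (G t (A t)) (Set.Icc a b) t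

/-- `K = Q R` is a (reduced) QR factorization: `Q` has orthonormal columns and `R` is square upper
triangular (possibly singular). -/
structure IsQR {d r : ℕ} (K Q : Matrix (Fin d) (Fin r) ℝ) (R : Matrix (Fin r) (Fin r) ℝ) :
    Prop where
  orthonormal : Qᵀ * Q = 1
  upper : R.BlockTriangular id
  eq_mul : K = Q * R

/-- One time step of the (skew-)symmetry preserving integrator from `t₀` to `t₁`, from
`Y₀ = U₀ S₀ U₀ᵀ` to `Y₁ = U₁ S₁ U₁ᵀ`. -/
def IsStep {d r : ℕ} (F : ℝ → Matrix (Fin d) (Fin d) ℝ → Matrix (Fin d) (Fin d) ℝ) (t₀ t₁ : ℝ)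
    (U₀ : Matrix (Fin d) (Fin r) ℝ) (S₀ : Matrix (Fin r) (Fin r) ℝ)
    (U₁ : Matrix (Fin d) (Fin r) ℝ) (S₁ : Matrix (Fin r) (Fin r) ℝ) : Prop :=
  (∃ (K : ℝ → Matrix (Fin d) (Fin r) ℝ) (R : Matrix (Fin r) (Fin r) ℝ),
    K t₀ = U₀ * S₀ ∧
    SolvesOn (fun t X => F t (X * U₀ᵀ) * U₀) t₀ t₁ K ∧
    IsQR (K t₁) U₁ R) ∧
  (∃ S : ℝ → Matrix (Fin r) (Fin r) ℝ,
    S t₀ = U₁ᵀ * (U₀ * S₀ * U₀ᵀ) * U₁ ∧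
    SolvesOn (fun t X => U₁ᵀ * F t (U₁ * X * U₁ᵀ) * U₁) t₀ t₁ S ∧
    S₁ = S t₁)

end LowRank

namespace LowRank

/-! Take one step from `Y₀ = U₀ S₀ U₀ᵀ` and put `G = Y₀ + A t₁ - A t₀`, so that `G - A t₁` is
exactly the old error. With `P₀ = U₀ U₀ᵀ` and `P₁ = U₁ U₁ᵀ`, the K-step makes the range of `P₁`
contain that of `K t₁`, and `K U₀ᵀ` follows the increment of `A` multiplied by `P₀`. Hence `(1 - P₁)
G` consists of a Lipschitz defect and of `(1 - P₁)(A t₁ - A t₀)(1 - P₀)`, which the `ε`-hypothesis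
controls. As `G` is (skew-)symmetric, `G (1 - P₁)` is equally small, so `P₁ G P₁` is close to `G`:
one basis update serves both sides. The S-step follows `P₁ G P₁` up to another Lipschitz defect.

The new error is thus the old one times `1 + O(h)` plus `O(h (ε + h))` (`IsStep.error_bound`), and a
discrete Grönwall argument sums the steps. Only orthogonal projections are applied and no core
matrix is inverted, so neither singular values nor dimensions enter. -/

/-! ### Orthogonal projections in the Frobenius norm -/

lemma frobenius_norm_sq_eq_trace {m n : ℕ} (M : Matrix (Fin m) (Fin n) ℝ) :
    ‖M‖ ^ 2 = (Mᵀ * M).trace := by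
  rw [Matrix.frobenius_norm_def, ← Real.sqrt_eq_rpow, Real.sq_sqrt (by positivity),
    Finset.sum_comm]
  simp [Matrix.trace, Matrix.mul_apply, pow_two]

/-- Pythagoras: both factors are symmetric idempotents with sum `1`. This makes every projection
below a contraction. -/
lemma norm_sq_proj_add_norm_sq_compl {d r n : ℕ} {U : Matrix (Fin d) (Fin r) ℝ}
    (hU : Uᵀ * U = 1) (M : Matrix (Fin d) (Fin n) ℝ) :
    ‖M‖ ^ 2 = ‖U * Uᵀ * M‖ ^ 2 + ‖(1 - U * Uᵀ) * M‖ ^ 2 := by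
  have hP : U * Uᵀ * (U * Uᵀ) = U * Uᵀ := by
    rw [Matrix.mul_assoc, ← Matrix.mul_assoc Uᵀ, hU, Matrix.one_mul]
  have hQ : (1 - U * Uᵀ) * (1 - U * Uᵀ) = 1 - U * Uᵀ := by
    simp [Matrix.sub_mul, Matrix.mul_sub, hP]
  simp only [frobenius_norm_sq_eq_trace, ← Matrix.trace_add]
  congr 1
  have e1 : (U * Uᵀ * M)ᵀ * (U * Uᵀ * M) = Mᵀ * (U * Uᵀ * (U * Uᵀ)) * M := by
    simp [Matrix.transpose_mul, Matrix.mul_assoc]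
  have e2 : ((1 - U * Uᵀ) * M)ᵀ * ((1 - U * Uᵀ) * M) =
      Mᵀ * ((1 - U * Uᵀ) * (1 - U * Uᵀ)) * M := by
    simp [Matrix.transpose_mul, Matrix.mul_assoc]
  rw [e1, e2, hP, hQ, ← Matrix.add_mul, ← Matrix.mul_add]
  simp

lemma norm_proj_mul_le {d r n : ℕ} {U : Matrix (Fin d) (Fin r) ℝ}
    (hU : Uᵀ * U = 1) (M : Matrix (Fin d) (Fin n) ℝ) : ‖U * Uᵀ * M‖ ≤ ‖M‖ := by
  refine le_of_sq_le_sq ?_ (norm_nonneg _)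
  have := norm_sq_proj_add_norm_sq_compl hU M
  nlinarith [sq_nonneg ‖(1 - U * Uᵀ) * M‖]

lemma norm_compl_mul_le {d r n : ℕ} {U : Matrix (Fin d) (Fin r) ℝ}
    (hU : Uᵀ * U = 1) (M : Matrix (Fin d) (Fin n) ℝ) : ‖(1 - U * Uᵀ) * M‖ ≤ ‖M‖ := by
  refine le_of_sq_le_sq ?_ (norm_nonneg _)
  have := norm_sq_proj_add_norm_sq_compl hU M
  nlinarith [sq_nonneg ‖U * Uᵀ * M‖]

lemma norm_mul_proj_le {d r n : ℕ} {U : Matrix (Fin d) (Fin r) ℝ}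
    (hU : Uᵀ * U = 1) (M : Matrix (Fin n) (Fin d) ℝ) : ‖M * (U * Uᵀ)‖ ≤ ‖M‖ := by
  rw [← Matrix.frobenius_norm_transpose, ← Matrix.frobenius_norm_transpose M]
  simpa [Matrix.transpose_mul] using norm_proj_mul_le hU Mᵀ

lemma norm_mul_compl_le {d r n : ℕ} {U : Matrix (Fin d) (Fin r) ℝ}
    (hU : Uᵀ * U = 1) (M : Matrix (Fin n) (Fin d) ℝ) : ‖M * (1 - U * Uᵀ)‖ ≤ ‖M‖ := by
  rw [← Matrix.frobenius_norm_transpose, ← Matrix.frobenius_norm_transpose M]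
  simpa [Matrix.transpose_mul] using norm_compl_mul_le hU Mᵀ

lemma norm_proj_mul_proj_le {d r : ℕ} {U : Matrix (Fin d) (Fin r) ℝ}
    (hU : Uᵀ * U = 1) (M : Matrix (Fin d) (Fin d) ℝ) : ‖U * Uᵀ * M * (U * Uᵀ)‖ ≤ ‖M‖ :=
  (norm_mul_proj_le hU _).trans (norm_proj_mul_le hU _)

/-! ### Derivatives and increments of matrix curves -/

lemma hasDerivWithinAt_mul_mul {m n p q : ℕ} (M : Matrix (Fin p) (Fin m) ℝ)
    (N : Matrix (Fin n) (Fin q) ℝ) {X : ℝ → Matrix (Fin m) (Fin n) ℝ}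
    {X' : Matrix (Fin m) (Fin n) ℝ} {s : Set ℝ} {t : ℝ} (h : HasDerivWithinAt X X' s t) :
    HasDerivWithinAt (fun τ => M * X τ * N) (M * X' * N) s t := by
  let Φ : Matrix (Fin m) (Fin n) ℝ →ₗ[ℝ] Matrix (Fin p) (Fin q) ℝ :=
    { toFun := fun Z => M * Z * N
      map_add' := fun Z W => by simp [Matrix.mul_add, Matrix.add_mul]
      map_smul' := fun c Z => by simp }
  exact (LinearMap.toContinuousLinearMap Φ).hasFDerivAt.comp_hasDerivWithinAt t h

lemma hasDerivWithinAt_transpose {m n : ℕ} {X : ℝ → Matrix (Fin m) (Fin n) ℝ}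
    {X' : Matrix (Fin m) (Fin n) ℝ} {s : Set ℝ} {t : ℝ} (h : HasDerivWithinAt X X' s t) :
    HasDerivWithinAt (fun τ => (X τ)ᵀ) X'ᵀ s t := by
  let Φ : Matrix (Fin m) (Fin n) ℝ →ₗ[ℝ] Matrix (Fin n) (Fin m) ℝ :=
    { toFun := fun Z => Zᵀ
      map_add' := fun Z W => by simp
      map_smul' := fun c Z => by simp }
  exact (LinearMap.toContinuousLinearMap Φ).hasFDerivAt.comp_hasDerivWithinAt t h

lemma norm_increment_sub_le {m n : ℕ} {X X' : ℝ → Matrix (Fin m) (Fin n) ℝ} {a b C : ℝ}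
    (hX : ∀ t ∈ Set.Icc a b, HasDerivWithinAt X (X' t) (Set.Icc a b) t)
    (hC : ∀ t ∈ Set.Icc a b, ‖X' t‖ ≤ C) {t : ℝ} (ht : t ∈ Set.Icc a b) :
    ‖X t - X a‖ ≤ C * (t - a) := by
  have := (convex_Icc a b).norm_image_sub_le_of_norm_hasDerivWithin_le hX hC
    (Set.left_mem_Icc.2 (ht.1.trans ht.2)) ht
  rwa [Real.norm_of_nonneg (sub_nonneg.2 ht.1)] at this

/-! ### Normal component at possibly singular cores -/

/-- A bound on the normal component of a continuous field which holds at the matrices `U S Vᵀ` with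
invertible core extends to those with singular core. -/
lemma norm_compl_mul_compl_le {d r : ℕ} {f : Matrix (Fin d) (Fin d) ℝ → Matrix (Fin d) (Fin d) ℝ}
    (hf : Continuous f) {A : Matrix (Fin d) (Fin d) ℝ} {ρ ε : ℝ}
    (hε : ∀ (Y : Matrix (Fin d) (Fin d) ℝ) (U : Matrix (Fin d) (Fin r) ℝ)
      (S : Matrix (Fin r) (Fin r) ℝ) (V : Matrix (Fin d) (Fin r) ℝ),
      IsRankFactorization Y U S V → ‖Y - A‖ < ρ → ‖f Y - tangentProjection U V (f Y)‖ ≤ ε)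
    {U V : Matrix (Fin d) (Fin r) ℝ} (hU : Uᵀ * U = 1) (hV : Vᵀ * V = 1)
    (S : Matrix (Fin r) (Fin r) ℝ) (hY : ‖U * S * Vᵀ - A‖ < ρ) :
    ‖(1 - U * Uᵀ) * f (U * S * Vᵀ) * (1 - V * Vᵀ)‖ ≤ ε := by
  -- The core is shifted to `S + μ I`, written as in the definition of the spectrum of `-S`. That
  -- spectrum is finite, so the core is invertible for all small `μ ≠ 0`, and the bound survives `μ
  -- → 0`.
  let Y : ℝ → Matrix (Fin d) (Fin d) ℝ := fun μ => U * (algebraMap ℝ _ μ - -S) * Vᵀ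
  have hYc : Continuous Y := by
    have : Continuous fun μ : ℝ => algebraMap ℝ (Matrix (Fin r) (Fin r) ℝ) μ :=
      continuous_algebraMap ℝ _
    fun_prop
  have hY0 : Y 0 = U * S * Vᵀ := by simp [Y]
  have hc : Continuous fun μ => ‖(1 - U * Uᵀ) * f (Y μ) * (1 - V * Vᵀ)‖ := by fun_prop
  rw [← hY0] at hY ⊢
  have h1 : ∀ᶠ μ in nhdsWithin (0 : ℝ) {0}ᶜ, ‖Y μ - A‖ < ρ :=
    nhdsWithin_le_nhds (((hYc.sub continuous_const).norm.continuousAt).eventually_lt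
      continuousAt_const hY)
  have h2 : ∀ᶠ μ in nhdsWithin (0 : ℝ) {0}ᶜ, μ ∉ spectrum ℝ (-S) := by
    have hfin : (spectrum ℝ (-S) \ {0}).Finite := (Matrix.finite_real_spectrum).subset
      Set.sdiff_subset
    have : (spectrum ℝ (-S) \ {0})ᶜ ∈ nhds (0 : ℝ) := hfin.isClosed.isOpen_compl.mem_nhds (by simp)
    filter_upwards [nhdsWithin_le_nhds this, self_mem_nhdsWithin] with μ hμ hμ0 hs
    exact hμ ⟨hs, hμ0⟩
  refine le_of_tendsto (x := nhdsWithin (0 : ℝ) {0}ᶜ)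
    (hc.continuousAt.tendsto.mono_left nhdsWithin_le_nhds) ?_
  filter_upwards [h1, h2] with μ hμ hs
  have := hε (Y μ) U _ V ⟨hU, hV, spectrum.notMem_iff.1 hs, rfl⟩ hμ
  refine le_of_eq_of_le (congrArg _ ?_) this
  -- `Z - P(Y) Z` factors as `(1 - U Uᵀ) Z (1 - V Vᵀ)`.
  rw [tangentProjection]
  noncomm_ring

/-! ### Preservation of (skew-)symmetry -/

lemma HasSymmetry.conj {m k : ℕ} {σ : ℝ} {M : Matrix (Fin m) (Fin m) ℝ} (hM : HasSymmetry σ M)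
    (U : Matrix (Fin k) (Fin m) ℝ) : HasSymmetry σ (U * M * Uᵀ) := by
  unfold HasSymmetry at *
  simp [Matrix.transpose_mul, hM, Matrix.mul_assoc]

lemma norm_smul_transpose {m : ℕ} {σ : ℝ} (hσ : σ = 1 ∨ σ = -1) (M : Matrix (Fin m) (Fin m) ℝ) :
    ‖σ • Mᵀ‖ = ‖M‖ := by
  rcases hσ with rfl | rfl <;> simp [Matrix.frobenius_norm_transpose]

lemma hasSymmetry_iff {m : ℕ} {σ : ℝ} (hσ : σ = 1 ∨ σ = -1) {M : Matrix (Fin m) (Fin m) ℝ} :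
    HasSymmetry σ M ↔ M - σ • Mᵀ = 0 := by
  unfold HasSymmetry
  rw [sub_eq_zero]
  rcases hσ with rfl | rfl
  · simp [eq_comm]
  · simp [eq_neg_iff_add_eq_zero, add_comm]

/-- The flow of a Lipschitz field that preserves (skew-)symmetry preserves (skew-)symmetry. -/
lemma SolvesOn.hasSymmetry {m : ℕ} {σ L a b : ℝ} (hσ : σ = 1 ∨ σ = -1)
    {G : ℝ → Matrix (Fin m) (Fin m) ℝ → Matrix (Fin m) (Fin m) ℝ}
    (hG : ∀ t ∈ Set.Icc a b, ∀ Y, HasSymmetry σ Y → HasSymmetry σ (G t Y))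
    (hL : ∀ t ∈ Set.Icc a b, ∀ Y Y', ‖G t Y - G t Y'‖ ≤ L * ‖Y - Y'‖)
    {Y : ℝ → Matrix (Fin m) (Fin m) ℝ} (hY : SolvesOn G a b Y) (h0 : HasSymmetry σ (Y a))
    {t : ℝ} (ht : t ∈ Set.Icc a b) : HasSymmetry σ (Y t) := by
  have hσσ : σ * σ = 1 := by rcases hσ with rfl | rfl <;> norm_num
  have hD : ∀ t ∈ Set.Icc a b, HasDerivWithinAt (fun τ => Y τ - σ • (Y τ)ᵀ)
      (G t (Y t) - σ • (G t (Y t))ᵀ) (Set.Icc a b) t := fun t ht =>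
    (hY t ht).sub ((hasDerivWithinAt_transpose (hY t ht)).const_smul σ)
  have hbound : ∀ t ∈ Set.Icc a b,
      ‖G t (Y t) - σ • (G t (Y t))ᵀ‖ ≤ L * ‖Y t - σ • (Y t)ᵀ‖ := by
    intro t ht
    -- `Z` is the (skew-)symmetric part of `Y t`, at distance half the defect. `G t Z` has no
    -- defect, so the two Lipschitz terms add up to `L` times the defect, and Grönwall from zero
    -- applies.
    set Z : Matrix (Fin m) (Fin m) ℝ := (1 / 2 : ℝ) • (Y t + σ • (Y t)ᵀ) with hZ
    have hZs : HasSymmetry σ Z := by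
      unfold HasSymmetry
      rw [hZ, Matrix.transpose_smul, Matrix.transpose_add, Matrix.transpose_smul,
        Matrix.transpose_transpose, smul_comm σ, smul_add σ, smul_smul σ σ, hσσ, one_smul, add_comm]
    have hYZ : Y t - Z = (1 / 2 : ℝ) • (Y t - σ • (Y t)ᵀ) := by rw [hZ]; module
    have hGZ := (hasSymmetry_iff hσ).1 (hG t ht Z hZs)
    have e : G t (Y t) - σ • (G t (Y t))ᵀ =
        (G t (Y t) - G t Z) - σ • (G t (Y t) - G t Z)ᵀ := by
      rw [Matrix.transpose_sub, smul_sub]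
      rw [sub_eq_zero] at hGZ
      rw [← hGZ]; abel
    have h1 := hL t ht (Y t) Z
    rw [hYZ, norm_smul, Real.norm_of_nonneg (by norm_num)] at h1
    calc _ ≤ ‖G t (Y t) - G t Z‖ + ‖G t (Y t) - G t Z‖ := by
          rw [e]; exact (norm_sub_le _ _).trans_eq (by rw [norm_smul_transpose hσ])
      _ ≤ _ := by linarith
  have hgr := norm_le_gronwallBound_of_norm_deriv_right_le (δ := 0) (K := L) (ε := 0)
    (fun t ht => (hD t ht).continuousWithinAt)
    (fun t ht => (hD t ⟨ht.1, ht.2.le⟩).mono_of_mem_nhdsWithin (Icc_mem_nhdsGE_of_mem ht))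
    (by rw [(hasSymmetry_iff hσ).1 h0, norm_zero])
    (fun t ht => by simpa using hbound t ⟨ht.1, ht.2.le⟩) t ht
  rw [gronwallBound_ε0_δ0] at hgr
  exact (hasSymmetry_iff hσ).2 (norm_le_zero_iff.1 hgr)

/-! ### Local error of one step -/

/-- One step of the integrator, compared with a solution `A` passing within distance `e` of the
starting value. -/
lemma IsStep.error_bound {d r : ℕ} {σ L B e ε ρ t₀ t₁ : ℝ} (hσ : σ = 1 ∨ σ = -1)
    (hL0 : 0 ≤ L) (ht : t₀ ≤ t₁)
    {F : ℝ → Matrix (Fin d) (Fin d) ℝ → Matrix (Fin d) (Fin d) ℝ}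
    {A : ℝ → Matrix (Fin d) (Fin d) ℝ}
    (hFσ : ∀ t ∈ Set.Icc t₀ t₁, ∀ Y, HasSymmetry σ Y → HasSymmetry σ (F t Y))
    (hA : SolvesOn F t₀ t₁ A) (hAσ : ∀ t ∈ Set.Icc t₀ t₁, HasSymmetry σ (A t))
    (hL : ∀ t ∈ Set.Icc t₀ t₁, ∀ Y Y', ‖F t Y - F t Y'‖ ≤ L * ‖Y - Y'‖)
    (hB : ∀ t ∈ Set.Icc t₀ t₁, ∀ Y, ‖F t Y‖ ≤ B)
    (hε : ∀ t ∈ Set.Icc t₀ t₁, ∀ (Y : Matrix (Fin d) (Fin d) ℝ) (U : Matrix (Fin d) (Fin r) ℝ)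
      (S : Matrix (Fin r) (Fin r) ℝ) (V : Matrix (Fin d) (Fin r) ℝ),
      IsRankFactorization Y U S V → ‖Y - A t‖ < ρ →
      ‖F t Y - tangentProjection U V (F t Y)‖ ≤ ε)
    {U₀ U₁ : Matrix (Fin d) (Fin r) ℝ} {S₀ S₁ : Matrix (Fin r) (Fin r) ℝ}
    (hU₀ : U₀ᵀ * U₀ = 1) (hS₀ : HasSymmetry σ S₀) (he : ‖U₀ * S₀ * U₀ᵀ - A t₀‖ ≤ e)
    (hρ : e + 2 * B * (t₁ - t₀) < ρ) (hstep : IsStep F t₀ t₁ U₀ S₀ U₁ S₁) :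
    U₁ᵀ * U₁ = 1 ∧ HasSymmetry σ S₁ ∧
      ‖U₁ * S₁ * U₁ᵀ - A t₁‖ ≤ e
        + 2 * ((t₁ - t₀) * (ε + 2 * L * (e + 2 * B * (t₁ - t₀))))
        + (t₁ - t₀) * (L * (e + 4 * B * (t₁ - t₀)
          + 2 * ((t₁ - t₀) * (ε + 2 * L * (e + 2 * B * (t₁ - t₀)))))) := by
  obtain ⟨⟨K, R, hK0, hK, hQR⟩, S, hS0, hS, rfl⟩ := hstep
  have hU₁ := hQR.orthonormal
  have h0m : t₀ ∈ Set.Icc t₀ t₁ := Set.left_mem_Icc.2 ht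
  have h1m : t₁ ∈ Set.Icc t₀ t₁ := Set.right_mem_Icc.2 ht
  have hB0 : 0 ≤ B := (norm_nonneg _).trans (hB t₀ h0m 0)
  set h := t₁ - t₀ with hh
  have hh0 : 0 ≤ h := sub_nonneg.2 ht
  set Y₀ := U₀ * S₀ * U₀ᵀ with hY₀
  set P₀ := U₀ * U₀ᵀ with hP₀
  set P₁ := U₁ * U₁ᵀ with hP₁
  -- increments over subintervals
  have hsub : ∀ t ∈ Set.Icc t₀ t₁, B * (t - t₀) ≤ B * h := fun t ht' =>
    mul_le_mul_of_nonneg_left (by linarith [ht'.2]) hB0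
  have hAinc : ∀ t ∈ Set.Icc t₀ t₁, ‖A t - A t₀‖ ≤ B * h := fun t ht' =>
    (norm_increment_sub_le hA (fun s hs => hB s hs _) ht').trans (hsub t ht')
  set X : ℝ → Matrix (Fin d) (Fin d) ℝ := fun t => K t * U₀ᵀ with hX
  have hXd : ∀ t ∈ Set.Icc t₀ t₁, HasDerivWithinAt X (F t (X t) * P₀) (Set.Icc t₀ t₁) t := by
    intro t ht'
    have := hasDerivWithinAt_mul_mul (1 : Matrix (Fin d) (Fin d) ℝ) U₀ᵀ (hK t ht')
    simpa [hX, hP₀, Matrix.mul_assoc] using this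
  have hX0 : X t₀ = Y₀ := by simp [hX, hK0, hY₀]
  have hXinc : ∀ t ∈ Set.Icc t₀ t₁, ‖X t - Y₀‖ ≤ B * h := fun t ht' => by
    rw [← hX0]
    exact (norm_increment_sub_le hXd
      (fun s hs => (norm_mul_proj_le hU₀ _).trans (hB s hs _)) ht').trans (hsub t ht')
  have hX1 : X t₁ = U₁ * R * U₀ᵀ := by simp [hX, hQR.eq_mul]
  have hXA : ∀ s ∈ Set.Icc t₀ t₁, ∀ t ∈ Set.Icc t₀ t₁, ‖X s - A t‖ ≤ e + 2 * B * h := by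
    intro s hs t ht'
    have e1 : X s - A t = (X s - Y₀) + (Y₀ - A t₀) - (A t - A t₀) := by abel
    rw [e1]
    have := norm_sub_le ((X s - Y₀) + (Y₀ - A t₀)) (A t - A t₀)
    have := norm_add_le (X s - Y₀) (Y₀ - A t₀)
    linarith [hXinc s hs, hAinc t ht']
  have hFXA : ∀ s ∈ Set.Icc t₀ t₁, ∀ t ∈ Set.Icc t₀ t₁,
      ‖F t (A t) - F t (X s)‖ ≤ L * (e + 2 * B * h) := fun s hs t ht' =>
    (hL t ht' _ _).trans (mul_le_mul_of_nonneg_left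
      (by rw [norm_sub_rev]; exact hXA s hs t ht') hL0)
  have hnormal : ‖(1 - P₁) * (A t₁ - A t₀) * (1 - P₀)‖ ≤ (ε + L * (e + 2 * B * h)) * h := by
    have hd : ∀ t ∈ Set.Icc t₀ t₁, HasDerivWithinAt (fun τ => (1 - P₁) * A τ * (1 - P₀))
        ((1 - P₁) * F t (A t) * (1 - P₀)) (Set.Icc t₀ t₁) t := fun t ht' =>
      hasDerivWithinAt_mul_mul _ _ (hA t ht')
    have hb : ∀ t ∈ Set.Icc t₀ t₁,
        ‖(1 - P₁) * F t (A t) * (1 - P₀)‖ ≤ ε + L * (e + 2 * B * h) := by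
      intro t ht'
      have hcont : Continuous (F t) :=
        (LipschitzWith.of_dist_le_mul (K := L.toNNReal) fun Y Y' => by
          simpa only [dist_eq_norm, Real.coe_toNNReal L hL0] using hL t ht' Y Y').continuous
      -- The field is evaluated at the frozen matrix `X t₁` for every `t`: only at `t₁` is the left
      -- factor known to be `U₁`. The core `R` may be singular.
      have h1 := norm_compl_mul_compl_le hcont (hε t ht') hU₁ hU₀ R
        (by rw [← hX1]; exact (hXA t₁ h1m t ht').trans_lt hρ)
      rw [← hX1] at h1
      have e1 : (1 - P₁) * F t (A t) * (1 - P₀) = (1 - P₁) * F t (X t₁) * (1 - P₀)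
          + (1 - P₁) * (F t (A t) - F t (X t₁)) * (1 - P₀) := by noncomm_ring
      rw [e1]
      exact (norm_add_le _ _).trans (add_le_add h1 (((norm_mul_compl_le hU₀ _).trans
        (norm_compl_mul_le hU₁ _)).trans (hFXA t₁ h1m t ht')))
    have := norm_increment_sub_le hd hb h1m
    refine le_of_eq_of_le (congrArg _ ?_) this
    noncomm_ring
  have htangent : ‖(A t₁ - A t₀) * P₀ - (X t₁ - Y₀)‖ ≤ L * (e + 2 * B * h) * h := by
    have hd : ∀ t ∈ Set.Icc t₀ t₁, HasDerivWithinAt (fun τ => A τ * P₀ - X τ)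
        ((F t (A t) - F t (X t)) * P₀) (Set.Icc t₀ t₁) t := fun t ht' => by
      have h1 := hasDerivWithinAt_mul_mul (1 : Matrix (Fin d) (Fin d) ℝ) P₀ (hA t ht')
      simp only [Matrix.one_mul] at h1
      rw [Matrix.sub_mul]
      exact h1.sub (hXd t ht')
    have := norm_increment_sub_le hd
      (fun t ht' => (norm_mul_proj_le hU₀ _).trans (hFXA t ht' t ht')) h1m
    refine le_of_eq_of_le (congrArg _ ?_) this
    rw [hX0]; noncomm_ring
  -- `G` is the starting value transported along `A`
  set G := Y₀ + (A t₁ - A t₀) with hG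
  set η := h * (ε + 2 * L * (e + 2 * B * h)) with hη
  have hY₀σ : HasSymmetry σ Y₀ := hS₀.conj U₀
  have hGσ : HasSymmetry σ G := by
    have h1 := hAσ t₁ h1m
    have h0 := hAσ t₀ h0m
    unfold HasSymmetry at *
    rw [hG, Matrix.transpose_add, Matrix.transpose_sub, h1, h0, hY₀σ, smul_add, smul_sub]
  have hleft : ‖(1 - P₁) * G‖ ≤ η := by
    have hz : (1 - P₁) * X t₁ = 0 := by
      have : P₁ * U₁ = U₁ := by rw [hP₁, Matrix.mul_assoc, hU₁, Matrix.mul_one]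
      rw [hX1, ← Matrix.mul_assoc, ← Matrix.mul_assoc, Matrix.sub_mul, this]
      simp
    have e1 : (1 - P₁) * G = (1 - P₁) * X t₁ + (1 - P₁) * ((A t₁ - A t₀) * P₀ - (X t₁ - Y₀))
        + (1 - P₁) * (A t₁ - A t₀) * (1 - P₀) := by rw [hG]; noncomm_ring
    rw [e1, hz, zero_add]
    have h1 := norm_add_le ((1 - P₁) * ((A t₁ - A t₀) * P₀ - (X t₁ - Y₀)))
      ((1 - P₁) * (A t₁ - A t₀) * (1 - P₀))
    have h2 := norm_compl_mul_le hU₁ ((A t₁ - A t₀) * P₀ - (X t₁ - Y₀))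
    rw [hη]
    linarith
  have hright : ‖G * (1 - P₁)‖ ≤ η := by
    -- Transposition turns the left defect into the right one; no second basis update is needed.
    have : σ • ((1 - P₁) * G)ᵀ = G * (1 - P₁) := by
      have hσσ : σ * σ = 1 := by rcases hσ with rfl | rfl <;> norm_num
      have hP : (1 - P₁)ᵀ = 1 - P₁ := by simp [hP₁, Matrix.transpose_mul]
      unfold HasSymmetry at hGσ
      rw [Matrix.transpose_mul, hGσ, hP, Matrix.smul_mul, smul_smul, hσσ, one_smul]
    rw [← this, norm_smul_transpose hσ]
    exact hleft
  have hboth : ‖P₁ * G * P₁ - G‖ ≤ 2 * η := by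
    have e1 : P₁ * G * P₁ - G = -((1 - P₁) * G + P₁ * (G * (1 - P₁))) := by noncomm_ring
    rw [e1, norm_neg]
    have h1 := norm_add_le ((1 - P₁) * G) (P₁ * (G * (1 - P₁)))
    have h2 := norm_proj_mul_le hU₁ (G * (1 - P₁))
    linarith
  -- the S-step, lifted to `d × d` matrices
  set W : ℝ → Matrix (Fin d) (Fin d) ℝ := fun t => U₁ * S t * U₁ᵀ with hW
  have hWd : SolvesOn (fun t Y => P₁ * F t Y * P₁) t₀ t₁ W := by
    intro t ht'
    have := hasDerivWithinAt_mul_mul U₁ U₁ᵀ (hS t ht')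
    simpa [hW, hP₁, Matrix.mul_assoc] using this
  have hW0 : W t₀ = P₁ * Y₀ * P₁ := by simp [hW, hS0, hP₁, Matrix.mul_assoc]
  have hP₁t : P₁ᵀ = P₁ := by simp [hP₁, Matrix.transpose_mul]
  have hWσ : HasSymmetry σ (W t₁) := by
    refine hWd.hasSymmetry (L := L) hσ (fun t ht' Y hY => ?_) (fun t ht' Y Y' => ?_) ?_ h1m
    · simpa [hP₁t] using (hFσ t ht' Y hY).conj P₁
    · rw [← Matrix.sub_mul, ← Matrix.mul_sub]
      exact (norm_proj_mul_proj_le hU₁ _).trans (hL t ht' _ _)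
    · rw [hW0]
      simpa [hP₁t] using hY₀σ.conj P₁
  have hS₁σ : HasSymmetry σ (S t₁) := by
    have h1 := hWσ.conj U₁ᵀ
    have : U₁ᵀ * W t₁ * U₁ᵀᵀ = S t₁ := by
      rw [Matrix.transpose_transpose, hW]
      calc U₁ᵀ * (U₁ * S t₁ * U₁ᵀ) * U₁ = (U₁ᵀ * U₁) * S t₁ * (U₁ᵀ * U₁) := by
            simp only [Matrix.mul_assoc]
        _ = _ := by rw [hU₁]; simp
    rwa [this] at h1
  have hWinc : ∀ t ∈ Set.Icc t₀ t₁, ‖W t - W t₀‖ ≤ B * h := fun t ht' =>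
    (norm_increment_sub_le hWd (fun s hs => (norm_proj_mul_proj_le hU₁ _).trans (hB s hs _))
      ht').trans (hsub t ht')
  -- A crude `O(h)` bound suffices: it enters the error only after multiplication by `L * h`.
  have hWY : ‖W t₀ - Y₀‖ ≤ 2 * η + 2 * B * h := by
    have e1 : W t₀ - Y₀ = (P₁ * G * P₁ - G) - P₁ * (A t₁ - A t₀) * P₁ + (A t₁ - A t₀) := by
      rw [hW0, hG]; noncomm_ring
    rw [e1]
    have h1 := norm_add_le ((P₁ * G * P₁ - G) - P₁ * (A t₁ - A t₀) * P₁) (A t₁ - A t₀)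
    have h2 := norm_sub_le (P₁ * G * P₁ - G) (P₁ * (A t₁ - A t₀) * P₁)
    have h3 := norm_proj_mul_proj_le hU₁ (A t₁ - A t₀)
    linarith [hAinc t₁ h1m]
  have hWA : ∀ t ∈ Set.Icc t₀ t₁, ‖W t - A t‖ ≤ e + 4 * B * h + 2 * η := by
    intro t ht'
    have e1 : W t - A t = (W t - W t₀) + (W t₀ - Y₀) + (Y₀ - A t₀) - (A t - A t₀) := by abel
    rw [e1]
    have h1 := norm_sub_le ((W t - W t₀) + (W t₀ - Y₀) + (Y₀ - A t₀)) (A t - A t₀)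
    have h2 := norm_add₃_le (a := W t - W t₀) (b := W t₀ - Y₀) (c := Y₀ - A t₀)
    linarith [hAinc t ht', hWinc t ht']
  have hWG : ‖W t₁ - P₁ * G * P₁‖ ≤ L * (e + 4 * B * h + 2 * η) * h := by
    have hd : ∀ t ∈ Set.Icc t₀ t₁, HasDerivWithinAt (fun τ => W τ - P₁ * A τ * P₁)
        (P₁ * (F t (W t) - F t (A t)) * P₁) (Set.Icc t₀ t₁) t := fun t ht' => by
      rw [Matrix.mul_sub, Matrix.sub_mul]
      exact (hWd t ht').sub (hasDerivWithinAt_mul_mul P₁ P₁ (hA t ht'))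
    have := norm_increment_sub_le hd (fun t ht' => (norm_proj_mul_proj_le hU₁ _).trans
      ((hL t ht' _ _).trans (mul_le_mul_of_nonneg_left (hWA t ht') hL0))) h1m
    refine le_of_eq_of_le (congrArg _ ?_) this
    rw [hW0, hG]; noncomm_ring
  refine ⟨hU₁, hS₁σ, ?_⟩
  have e1 : W t₁ - A t₁ = (W t₁ - P₁ * G * P₁) + (P₁ * G * P₁ - G) + (Y₀ - A t₀) := by
    rw [hG]; abel
  change ‖W t₁ - A t₁‖ ≤ _
  rw [e1]
  have h2 := norm_add₃_le (a := W t₁ - P₁ * G * P₁) (b := P₁ * G * P₁ - G) (c := Y₀ - A t₀)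
  linarith

/-! ### Accumulation over the steps -/

/-- The closed form `exp (C k h) (δ + k h g)` dominates the error recursion because `1 + C h ≤ exp
(C h)`, and the new source term `h g` only grows when multiplied by an exponential that is at least
`1`. -/
lemma discrete_gronwall_step {C g δ h e e' : ℝ} (hC : 0 ≤ C) (hg : 0 ≤ g) (hδ : 0 ≤ δ) (hh : 0 ≤ h)
    (k : ℕ) (he : e = Real.exp (C * (k * h)) * (δ + k * h * g))
    (he' : e' ≤ e * (1 + C * h) + h * g) :
    e' ≤ Real.exp (C * ((k + 1 : ℕ) * h)) * (δ + (k + 1 : ℕ) * h * g) := by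
  have hs : Real.exp (C * ((k + 1 : ℕ) * h)) = Real.exp (C * (k * h)) * Real.exp (C * h) := by
    rw [← Real.exp_add]; push_cast; ring_nf
  have h1 : 1 + C * h ≤ Real.exp (C * h) := by linarith [Real.add_one_le_exp (C * h)]
  have h2 : 1 ≤ Real.exp (C * ((k + 1 : ℕ) * h)) := Real.one_le_exp (by positivity)
  have he0 : 0 ≤ e := by rw [he]; positivity
  calc e' ≤ e * Real.exp (C * h) + Real.exp (C * ((k + 1 : ℕ) * h)) * (h * g) := by
        refine he'.trans (add_le_add (mul_le_mul_of_nonneg_left h1 he0) ?_)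
        exact le_mul_of_one_le_left (by positivity) h2
    _ = _ := by rw [he, hs]; push_cast; ring

end LowRank

theorem theorem3p3 (L B T : ℝ) :
    ∃ c₀ c₁ c₂ : ℝ, 0 ≤ c₀ ∧ 0 ≤ c₁ ∧ 0 ≤ c₂ ∧
      ∀ (d r : ℕ) (σ : ℝ) (_ : σ = 1 ∨ σ = -1)
        (F : ℝ → Matrix (Fin d) (Fin d) ℝ → Matrix (Fin d) (Fin d) ℝ)
        (A : ℝ → Matrix (Fin d) (Fin d) ℝ)
        -- `F` preserves (skew-)symmetry, and `A` is a (skew-)symmetric solution on `[0, T]`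
        (_ : ∀ t ∈ Set.Icc 0 T, ∀ Y, LowRank.HasSymmetry σ Y → LowRank.HasSymmetry σ (F t Y))
        (_ : LowRank.SolvesOn F 0 T A)
        (_ : ∀ t ∈ Set.Icc 0 T, LowRank.HasSymmetry σ (A t))
        -- `F` is Lipschitz continuous and bounded (Frobenius norm)
        (_ : ∀ t ∈ Set.Icc 0 T, ∀ Y Y', ‖F t Y - F t Y'‖ ≤ L * ‖Y - Y'‖)
        (_ : ∀ t ∈ Set.Icc 0 T, ∀ Y, ‖F t Y‖ ≤ B)
        (δ ε h ρ : ℝ) (_ : 0 ≤ ε) (_ : 0 < h) (_ : 0 < ρ)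
        -- the non-tangential part of `F` is `ε`-small at the rank-`r` matrices in the
        -- `ρ`-neighbourhood of the solution, and this neighbourhood is not smaller than the
        -- error bound
        (_ : ∀ t ∈ Set.Icc 0 T, ∀ (Y : Matrix (Fin d) (Fin d) ℝ) (U : Matrix (Fin d) (Fin r) ℝ)
          (S : Matrix (Fin r) (Fin r) ℝ) (V : Matrix (Fin d) (Fin r) ℝ),
          LowRank.IsRankFactorization Y U S V → ‖Y - A t‖ < ρ →
          ‖F t Y - LowRank.tangentProjection U V (F t Y)‖ ≤ ε)
        (_ : c₀ * δ + c₁ * ε + c₂ * h ≤ ρ)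
        -- `n` steps of the integrator, starting from `U₀ S₀ U₀ᵀ`
        (U : ℕ → Matrix (Fin d) (Fin r) ℝ) (S : ℕ → Matrix (Fin r) (Fin r) ℝ)
        (_ : (U 0)ᵀ * U 0 = 1) (_ : LowRank.HasSymmetry σ (S 0))
        (_ : ‖U 0 * S 0 * (U 0)ᵀ - A 0‖ ≤ δ)
        (n : ℕ) (_ : (n : ℝ) * h ≤ T)
        (_ : ∀ k < n, LowRank.IsStep F ((k : ℝ) * h) (((k + 1 : ℕ) : ℝ) * h)
          (U k) (S k) (U (k + 1)) (S (k + 1))),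
        ‖U n * S n * (U n)ᵀ - A ((n : ℝ) * h)‖ ≤ c₀ * δ + c₁ * ε + c₂ * h := by
  set l := max L 0 with hl
  set b := max B 0 with hb
  set τ := max T 0 with hτ
  have hl0 : 0 ≤ l := le_max_right _ _
  have hb0 : 0 ≤ b := le_max_right _ _
  have hτ0 : 0 ≤ τ := le_max_right _ _
  -- `C`, `D₁`, `D₂` collect the coefficients of `h e`, `h ε`, `h ^ 2` in the local bound, one
  -- surplus factor `h` being replaced by `τ` in the higher-order terms.
  set C := 5 * l + 4 * l ^ 2 * τ with hC
  set D₁ := 2 + 2 * l * τ with hD₁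
  set D₂ := 12 * l * b + 8 * l ^ 2 * b * τ with hD₂
  have hC0 : 0 ≤ C := by positivity
  have hD₁0 : 0 ≤ D₁ := by positivity
  have hD₂0 : 0 ≤ D₂ := by positivity
  -- In the last constant, `2 b h` covers the motion of `A` and of the K-step within one step, and
  -- the extra `h` makes the inclusion in the `ρ`-neighbourhood strict.
  refine ⟨Real.exp (C * τ), Real.exp (C * τ) * τ * D₁, Real.exp (C * τ) * τ * D₂ + 2 * b + 1,
    by positivity, by positivity, by positivity, ?_⟩
  intro d r σ hσ F A hFσ hA hAσ hL hB δ ε h ρ hε0 hh _ hε hρ U S hU0 hS0 hδ n hn hstep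
  have hδ0 : 0 ≤ δ := (norm_nonneg _).trans hδ
  set g := D₁ * ε + D₂ * h with hg
  have hg0 : 0 ≤ g := by positivity
  have htime : ∀ k ≤ n, (k : ℝ) * h ≤ T := fun k hk =>
    (mul_le_mul_of_nonneg_right (by exact_mod_cast hk) hh.le).trans hn
  have hbound : ∀ k ≤ n, Real.exp (C * (k * h)) * (δ + k * h * g) ≤
      Real.exp (C * τ) * (δ + τ * g) := fun k hk => by
    have : (k : ℝ) * h ≤ τ := (htime k hk).trans (le_max_left _ _)
    gcongr
  have key : ∀ k ≤ n, (U k)ᵀ * U k = 1 ∧ LowRank.HasSymmetry σ (S k) ∧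
      ‖U k * S k * (U k)ᵀ - A (k * h)‖ ≤ Real.exp (C * (k * h)) * (δ + k * h * g) := by
    intro k
    induction k with
    | zero => intro _; simpa using ⟨hU0, hS0, hδ⟩
    | succ k ih =>
      intro hk
      obtain ⟨ihU, ihS, ihe⟩ := ih (by omega)
      have hlen : ((k + 1 : ℕ) : ℝ) * h - k * h = h := by push_cast; ring
      have hkh : 0 ≤ (k : ℝ) * h := by positivity
      have hsub : Set.Icc ((k : ℝ) * h) ((k + 1 : ℕ) * h) ⊆ Set.Icc 0 T :=
        Set.Icc_subset_Icc hkh (htime _ hk)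
      have hhτ : h ≤ τ := by
        have := (htime _ hk).trans (le_max_left T 0)
        linarith
      have hnear : Real.exp (C * (k * h)) * (δ + k * h * g) +
          2 * b * ((k + 1 : ℕ) * h - k * h) < ρ := by
        rw [hlen]
        have := hbound k (by omega)
        rw [hg] at this ⊢
        linarith
      obtain ⟨h1, h2, h3⟩ := (hstep k (by omega)).error_bound (L := l) (B := b) hσ hl0
        (by linarith) (fun t ht => hFσ t (hsub ht)) (fun t ht => (hA t (hsub ht)).mono hsub)
        (fun t ht => hAσ t (hsub ht))
        (fun t ht Y Y' => (hL t (hsub ht) Y Y').trans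
          (mul_le_mul_of_nonneg_right (le_max_left _ _) (norm_nonneg _)))
        (fun t ht Y => (hB t (hsub ht) Y).trans (le_max_left _ _))
        (fun t ht => hε t (hsub ht)) ihU ihS ihe hnear
      refine ⟨h1, h2, LowRank.discrete_gronwall_step hC0 hg0 hδ0 hh.le k rfl (h3.trans ?_)⟩
      rw [hlen]
      set e := Real.exp (C * (k * h)) * (δ + k * h * g)
      have he0 : 0 ≤ e := by positivity
      have hτh : 0 ≤ τ - h := sub_nonneg.2 hhτ
      -- This is exactly the slack left by replacing `h` by `τ` in the higher-order terms.
      have hrest : 0 ≤ (τ - h) * (h * l * (2 * ε + 4 * l * e + 8 * l * b * h)) := by positivity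
      rw [hg, hC, hD₁, hD₂]
      linarith
  refine (key n le_rfl).2.2.trans ((hbound n le_rfl).trans ?_)
  have : 0 ≤ (2 * b + 1) * h := by positivity
  rw [hg]
  linarith
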